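/- Let $r\in\{1,2,\dots,\infty\}$, let $M$ be a compact Riemannian $C^r$ manifold (without boundary, with a continuous metric tensor) and let $T:M\to M$ be a $C^r$ diffeomorphism. Let $X\subset M$ be compact and let $\mu$ be a Borel probability measure on $X$. Let $k\in\mathbb N$ satisfy $k\ge\dim M$ and $\mathcal H^k(X)=0$, where $\mathcal H^k$ is the $k$-dimensional Hausdorff measure for the Riemannian distance, and assume that $\mu\big(\bigcup_{p=1}^{k-1}\{x\in M: T^px=x\}\big)=0$. For $h:M\to\mathbb R$ put $\phi_{h,k}(x)=(h(x),h(Tx),\dots,h(T^{k-1}x))\in\mathbb R^k$ (with the Euclidean norm), and for $\varepsilon>0$ and $y\in\operatorname{supp}((\phi_{h,k})_*\mu)$ let $P=\phi_{h,k}^{-1}(B(y,\varepsilon))$, where $B(y,\varepsilon)$ is the open ball, $$\chi_{h,\varepsilon}(y)=\frac1{\mu(P)}\int_P\phi_{h,k}\circ T\,d\mu,\qquad \sigma_{h,\varepsilon}(y)=\Big(\frac1{\mu(P)}\int_P\|\phi_{h,k}\circ T-\chi_{h,\varepsilon}(y)\|^2\,d\mu\Big)^{1/2}.$$ Then for a prevalent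 $C^r$ observable $h:M\to\mathbb R$ the following holds: for $\mu$-a.e. $x$ the point $\phi_{h,k}(x)$ lies in $\operatorname{supp}((\phi_{h,k})_*\mu)$, and there is a constant $C=C(x,h)$ such that $$\sigma_{h,\varepsilon}(\phi_{h,k}(x))\le C\varepsilon\qquad\text{for all }\varepsilon>0.$$ Here $C^r(M,\mathbb R)$ carries the topology of uniform convergence of the derivatives of orders up to $r$ (all finite orders if $r=\infty$), and a set $S\subset C^r(M,\mathbb R)$ is prevalent if it contains a Borel set $B$ for which there is a Borel measure $\nu$ on $C^r(M,\mathbb R)$, positive and finite on some compact set, such that for every $v\in C^r(M,\mathbb R)$ one has $v+e\in B$ for $\nu$-almost every $e$. -/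

import Mathlib

open MeasureTheory
open scoped Manifold ContDiff Bundle

namespace DelayPrediction

/-- The `C^r` topology on the space `C^r(M, ℝ)` of a `C^r` manifold `M` (without boundary, of
dimension `d`), for `r ∈ {1, 2, …, ∞}`: locally uniform convergence, in every chart `e` of the
maximal `C^r` atlas, of all derivatives of (finite) order `j ≤ r` of the local representatives
`f ∘ e⁻¹`. For compact `M` this is the topology of uniform convergence of the derivatives of
orders up to `r`. -/
noncomputable instance crTopology {d : ℕ} {M : Type*} [TopologicalSpace M]
    [ChartedSpace (EuclideanSpace ℝ (Fin d)) M] (r : ℕ∞) :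
    TopologicalSpace (ContMDiffMap (𝓡 d) 𝓘(ℝ, ℝ) M ℝ (r : ℕ∞ω)) :=
  ⨅ (e ∈ IsManifold.maximalAtlas (𝓡 d) (r : ℕ∞ω) M) (j : ℕ) (_ : (j : ℕ∞) ≤ r),
    TopologicalSpace.induced
      (fun f => UniformOnFun.ofFun {K | IsCompact K ∧ K ⊆ e.target}
        (iteratedFDeriv ℝ j (fun y => f (e.symm y))))
      inferInstance

/-- A subset `S` of a topological vector space is prevalent if it contains a Borel set `B` for
which there is a Borel measure `ν`, positive and finite on some compact set, such that for every
`v` one has `v + e ∈ B` for `ν`-almost every `e`. -/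
def IsPrevalent {V : Type*} [TopologicalSpace V] [Add V] (S : Set V) : Prop :=
  ∃ B ⊆ S, MeasurableSet[borel V] B ∧
    ∃ ν : @Measure V (borel V),
      (∃ K : Set V, IsCompact K ∧ 0 < ν K ∧ ν K < ⊤) ∧ ∀ v : V, ∀ᵐ e ∂ν, v + e ∈ B

variable {M : Type*}

/-- The `k`-delay coordinate map `x ↦ (h x, h (T x), …, h (T^{k-1} x))`, with values in `ℝ^k` with
the Euclidean norm. -/
def delayMap (T : M → M) (h : M → ℝ) (k : ℕ) (x : M) : EuclideanSpace ℝ (Fin k) :=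
  WithLp.toLp 2 fun i => h (T^[i] x)

/-- The points whose delay vector lies in the open ball `B(y, ε)`. -/
def delayPreimage (T : M → M) (h : M → ℝ) (k : ℕ) (ε : ℝ) (y : EuclideanSpace ℝ (Fin k)) : Set M :=
  delayMap T h k ⁻¹' Metric.ball y ε

/-- The mean predicted future `χ_{h,ε}(y)`. -/
noncomputable def meanPrediction [MeasurableSpace M] (μ : Measure M) (T : M → M) (h : M → ℝ)
    (k : ℕ) (ε : ℝ) (y : EuclideanSpace ℝ (Fin k)) : EuclideanSpace ℝ (Fin k) :=
  (μ.real (delayPreimage T h k ε y))⁻¹ •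
    ∫ x in delayPreimage T h k ε y, delayMap T h k (T x) ∂μ

/-- The mean-square prediction error `σ_{h,ε}(y)`. -/
noncomputable def predictionError [MeasurableSpace M] (μ : Measure M) (T : M → M) (h : M → ℝ)
    (k : ℕ) (ε : ℝ) (y : EuclideanSpace ℝ (Fin k)) : ℝ :=
  √((μ.real (delayPreimage T h k ε y))⁻¹ *
    ∫ x in delayPreimage T h k ε y,
      ‖delayMap T h k (T x) - meanPrediction μ T h k ε y‖ ^ 2 ∂μ)

end DelayPrediction

/-! Write `φ` for the delay map. If `‖φ (T y) - φ (T x)‖ ≤ C ‖φ y - φ x‖` for all `y ∈ X`, then on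
the preimage of an `ε`-ball about `φ x` all futures lie within `C ε` of `φ (T x)`, so the prediction
error is at most `2 C ε` (`predictionError_le`). By compactness of `X` such a `C` exists as soon as
`φ` separates `x` from the rest of `X` and is an immersion at `x` (`exists_forall_norm_sub_le`).
Both conditions concern a single point `x`, so `k ≥ d` delays suffice and no embedding of `X` is
needed.

By Fubini it is enough to fix such an `x` and perturb the observable by almost every element of a
finite-dimensional probe (`isPrevalent_of_ae_probe`). The probe consists of polynomials in finitely
many functions; it interpolates at `2 k` points and contains an immersive observable near each orbit
segment of `k` distinct points (`exists_probe`). For almost every `x` the points `x, …, T^{k-1} x`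
are distinct, by the hypothesis on periodic points.

Immersion at `x` is then generic by an eigenvalue argument (`ae_injective_add`). Separation is
generic because, near a point `y₀` whose orbit segment avoids that of `x`, the parameters that fail
lie, in each slice by a suitable `k`-dimensional space, in a `C^1` image of `X`, hence in a Lebesgue
null set (`exists_nhds_ae_delayDiff_ne_zero`). Only finitely many other points remain
(`ae_delayDiff_ne_zero`). -/

namespace DelayPrediction

/-! ### Charts are locally Lipschitz for the Riemannian distance. -/

section RiemannianChart

set_option maxSynthPendingDepth 3

open Set Filter Manifold Metric Bundle
open scoped NNReal ENNReal Topology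

variable {E : Type*} [NormedAddCommGroup E] [NormedSpace ℝ E]
  {H : Type*} [TopologicalSpace H] (I : ModelWithCorners ℝ E H)
  {M : Type*} [PseudoEMetricSpace M] [ChartedSpace H M]
  [RiemannianBundle (fun x : M => TangentSpace I x)] [IsManifold I 1 M]

/-- The derivative of an extended chart, with values in the model vector space. -/
noncomputable def chartDeriv (x y : M) : TangentSpace I y →L[ℝ] E :=
  mfderiv I 𝓘(ℝ, E) (extChartAt I x) y

lemma exists_enorm_chartDeriv_le
    [IsContinuousRiemannianBundle E (fun x : M => TangentSpace I x)] (x : M) :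
    ∃ C : ℝ≥0, ∀ᶠ y in 𝓝 x, ∀ v : TangentSpace I y, ‖chartDeriv I x y v‖ₑ ≤ C * ‖v‖ₑ := by
  obtain ⟨C, -, hC⟩ := eventually_enorm_mfderiv_extChartAt_lt I x
  refine ⟨C, hC.mono fun y hy v => ?_⟩
  have hy' : ‖chartDeriv I x y‖ₑ ≤ C := hy.le
  exact ((chartDeriv I x y).le_opENorm v).trans (by gcongr)

/-- A `C^1` path staying in a region where the derivative of an extended chart is bounded by `C`
is lengthened by a factor at most `C` in the chart. -/
lemma edist_extChartAt_le_pathELength {x : M} {C : ℝ≥0} {u : Set M}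
    (hu : ∀ y ∈ u, ∀ v : TangentSpace I y, ‖chartDeriv I x y v‖ₑ ≤ C * ‖v‖ₑ)
    (hus : u ⊆ (chartAt H x).source)
    {γ : ℝ → M} (hγ : ContMDiffOn 𝓘(ℝ, ℝ) I 1 γ (Icc 0 1)) (hγu : MapsTo γ (Icc 0 1) u) :
    edist (extChartAt I x (γ 0)) (extChartAt I x (γ 1)) ≤ C * pathELength I γ 0 1 := by
  set γ' := extChartAt I x ∘ γ with hγ'
  have hC : ContMDiffOn 𝓘(ℝ, ℝ) 𝓘(ℝ, E) 1 γ' (Icc 0 1) :=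
    contMDiffOn_extChartAt.comp (I' := I) (t := (chartAt H x).source)
      hγ (fun t ht => hus (hγu ht))
  calc edist (extChartAt I x (γ 0)) (extChartAt I x (γ 1))
    _ = ‖γ' 1 - γ' 0‖ₑ := by rw [edist_comm, edist_eq_enorm_sub]; rfl
    _ ≤ ∫⁻ t in Icc 0 1, ‖derivWithin γ' (Icc 0 1) t‖ₑ := by
      apply enorm_sub_le_lintegral_derivWithin_Icc_of_contDiffOn_Icc _ zero_le_one
      rwa [← contMDiffOn_iff_contDiffOn]
    _ ≤ ∫⁻ t in Icc (0 : ℝ) 1, C * ‖mfderivWithin 𝓘(ℝ, ℝ) I γ (Icc 0 1) t 1‖ₑ := by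
      apply setLIntegral_mono' measurableSet_Icc (fun t ht ↦ ?_)
      have h1 : mfderivWithin 𝓘(ℝ, ℝ) 𝓘(ℝ, E) γ' (Icc 0 1) t =
          (mfderiv I 𝓘(ℝ, E) (extChartAt I x) (γ t)) ∘L
            (mfderivWithin 𝓘(ℝ, ℝ) I γ (Icc 0 1) t) := by
        apply mfderiv_comp_mfderivWithin
        · exact mdifferentiableAt_extChartAt (hus (hγu ht))
        · exact hγ.mdifferentiableOn one_ne_zero _ ht
        · rw [uniqueMDiffWithinAt_iff_uniqueDiffWithinAt]
          exact uniqueDiffOn_Icc zero_lt_one _ ht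
      have h2 : derivWithin γ' (Icc 0 1) t =
          chartDeriv I x (γ t) (mfderivWithin 𝓘(ℝ, ℝ) I γ (Icc 0 1) t 1) := by
        rw [← fderivWithin_derivWithin, ← mfderivWithin_eq_fderivWithin]
        exact congr($h1 1)
      rw [h2]
      exact hu _ (hγu ht) _
    _ = C * pathELength I γ 0 1 := by
      rw [lintegral_const_mul' _ _ ENNReal.coe_ne_top,
          pathELength_eq_lintegral_mfderivWithin_Icc]

/-- The extended charts of a manifold with a continuous Riemannian metric are locally Lipschitz
for the Riemannian distance. -/
theorem exists_lipschitzOnWith_extChartAt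
    [IsContinuousRiemannianBundle E (fun x : M => TangentSpace I x)] [IsRiemannianManifold I M]
    (x : M) :
    ∃ C : ℝ≥0, ∃ u ∈ 𝓝 x, LipschitzOnWith C (extChartAt I x) u := by
  obtain ⟨C, hC⟩ := exists_enorm_chartDeriv_le I x
  obtain ⟨ρ, hρ, hball⟩ := EMetric.mem_nhds_iff.1
    (inter_mem hC (chart_source_mem_nhds H x))
  -- Points within `ρ / 4` of `x` are joined by paths of length less than `ρ / 2`; these stay within
  -- `3 ρ / 4` of `x`, where the derivative bound holds.
  have h4 : 0 < ρ / 4 := ENNReal.div_pos hρ.ne' (by simp)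
  refine ⟨C, Metric.eball x (ρ / 4), Metric.eball_mem_nhds x h4, fun y hy z hz => ?_⟩
  have hyz : edist y z < ρ / 4 + ρ / 4 := by
    refine (edist_triangle_right y z x).trans_lt (ENNReal.add_lt_add hy hz)
  -- The infimum of the path lengths need not be attained: the estimate is proved for every `c`
  -- slightly above the distance, then `c` decreases to it.
  have key : ∀ c, edist y z < c → c ≤ ρ / 4 + ρ / 4 →
      edist (extChartAt I x y) (extChartAt I x z) ≤ C * c := by
    intro c hc hcρ
    rw [IsRiemannianManifold.out (I := I) y z] at hc
    obtain ⟨γ, h0, h1, hγ, hl⟩ := exists_lt_of_riemannianEDist_lt hc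
    have := edist_extChartAt_le_pathELength I (x := x) (C := C)
      (u := {y | ∀ v : TangentSpace I y, ‖chartDeriv I x y v‖ₑ ≤ C * ‖v‖ₑ} ∩
        (chartAt H x).source)
      (fun y hy => hy.1) inter_subset_right hγ ?_
    · rw [h0, h1] at this
      exact this.trans (by gcongr)
    · intro t ht
      apply hball
      have h3 : edist y (γ t) < c := by
        rw [IsRiemannianManifold.out (I := I) y (γ t)]
        refine (riemannianEDist_le_pathELength
          (hγ.mono (Icc_subset_Icc_right ht.2)) h0 rfl ht.1).trans_lt (lt_of_le_of_lt ?_ hl)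
        exact pathELength_mono le_rfl ht.2
      rw [Metric.mem_eball]
      calc edist (γ t) x ≤ edist y (γ t) + edist y x := by
            rw [edist_comm y (γ t)]; exact edist_triangle _ _ _
        _ < c + ρ / 4 := ENNReal.add_lt_add h3 hy
        _ ≤ (ρ / 4 + ρ / 4) + ρ / 4 := by gcongr
        _ ≤ (ρ / 4 + ρ / 4) + (ρ / 4 + ρ / 4) := by gcongr; exact le_self_add
        _ = ρ := by
          rw [← two_mul, ← two_mul, ← mul_assoc]
          norm_num
          exact ENNReal.mul_div_cancel (by norm_num) (by norm_num)
  obtain hlim : Tendsto (fun c : ℝ≥0∞ => (C : ℝ≥0∞) * c) (𝓝[>] edist y z)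
      (𝓝 (C * edist y z)) :=
    (ENNReal.Tendsto.const_mul tendsto_id (Or.inr ENNReal.coe_ne_top)).mono_left
      nhdsWithin_le_nhds
  have : (𝓝[>] edist y z).NeBot := nhdsGT_neBot_of_exists_gt ⟨_, hyz⟩
  refine ge_of_tendsto hlim ?_
  filter_upwards [Ioc_mem_nhdsGT hyz] with c hc using key c hc.1 hc.2

end RiemannianChart

/-! ### The `C^r` topology: linear operations and evaluation. -/

section CrTopology

open Set Filter
open scoped Topology

variable {d : ℕ} {M : Type*} [TopologicalSpace M] [ChartedSpace (EuclideanSpace ℝ (Fin d)) M]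
  {r : ℕ∞}

lemma contDiffOn_comp_symm (f : C^(r : ℕ∞ω)⟮𝓡 d, M; ℝ⟯)
    {e : OpenPartialHomeomorph M (EuclideanSpace ℝ (Fin d))}
    (he : e ∈ IsManifold.maximalAtlas (𝓡 d) (r : ℕ∞ω) M) :
    ContDiffOn ℝ (r : ℕ∞ω) (fun y => f (e.symm y)) e.target :=
  contMDiffOn_iff_contDiffOn.1
    (f.contMDiff.comp_contMDiffOn (contMDiffOn_symm_of_mem_maximalAtlas he))

lemma tendsto_crTopology_iff {ι : Type*} {l : Filter ι} {F : ι → C^(r : ℕ∞ω)⟮𝓡 d, M; ℝ⟯}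
    {f : C^(r : ℕ∞ω)⟮𝓡 d, M; ℝ⟯} :
    Tendsto F l (𝓝 f) ↔ ∀ e ∈ IsManifold.maximalAtlas (𝓡 d) (r : ℕ∞ω) M, ∀ j : ℕ, (j : ℕ∞) ≤ r →
      ∀ K, IsCompact K → K ⊆ e.target →
        TendstoUniformlyOn (fun i => iteratedFDeriv ℝ j fun y => F i (e.symm y))
          (iteratedFDeriv ℝ j fun y => f (e.symm y)) l K := by
  simp only [nhds_iInf, tendsto_iInf, nhds_induced, tendsto_comap_iff,
    UniformOnFun.tendsto_iff_tendstoUniformlyOn, mem_ofPred_eq, and_imp]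
  rfl

variable {e : OpenPartialHomeomorph M (EuclideanSpace ℝ (Fin d))}

lemma contDiffAt_comp_symm (f : C^(r : ℕ∞ω)⟮𝓡 d, M; ℝ⟯)
    (he : e ∈ IsManifold.maximalAtlas (𝓡 d) (r : ℕ∞ω) M) {j : ℕ} (hj : (j : ℕ∞) ≤ r)
    {y : EuclideanSpace ℝ (Fin d)} (hy : y ∈ e.target) :
    ContDiffAt ℝ j (fun y => f (e.symm y)) y :=
  ((contDiffOn_comp_symm f he).contDiffAt (e.open_target.mem_nhds hy)).of_le (by exact_mod_cast hj)

instance : ContinuousAdd C^(r : ℕ∞ω)⟮𝓡 d, M; ℝ⟯ where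
  continuous_add := by
    refine continuous_iff_continuousAt.2 fun p => tendsto_crTopology_iff.2
      fun e he j hj K hK hKe => ?_
    have h1 := tendsto_crTopology_iff.1 (continuous_fst.continuousAt (x := p)) e he j hj K hK hKe
    have h2 := tendsto_crTopology_iff.1 (continuous_snd.continuousAt (x := p)) e he j hj K hK hKe
    have key : ∀ f g : C^(r : ℕ∞ω)⟮𝓡 d, M; ℝ⟯, EqOn
        ((iteratedFDeriv ℝ j fun y => f (e.symm y)) + iteratedFDeriv ℝ j fun y => g (e.symm y))
        (iteratedFDeriv ℝ j fun y => (f + g) (e.symm y)) K := fun f g y hy =>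
      (iteratedFDeriv_add_apply (contDiffAt_comp_symm f he hj (hKe hy))
        (contDiffAt_comp_symm g he hj (hKe hy))).symm
    exact ((h1.add h2).congr (Eventually.of_forall fun q => key q.1 q.2)).congr_right (key p.1 p.2)

lemma continuous_smul_left (f : C^(r : ℕ∞ω)⟮𝓡 d, M; ℝ⟯) :
    Continuous fun c : ℝ => c • f := by
  refine continuous_iff_continuousAt.2 fun c => tendsto_crTopology_iff.2
    fun e he j hj K hK hKe => ?_
  have key : ∀ c : ℝ, EqOn (fun y => c • iteratedFDeriv ℝ j (fun y => f (e.symm y)) y)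
      (iteratedFDeriv ℝ j fun y => (c • f) (e.symm y)) K := fun c y hy =>
    (iteratedFDeriv_const_smul_apply (contDiffAt_comp_symm f he hj (hKe hy))).symm
  have hcont : ContinuousOn (iteratedFDeriv ℝ j fun y => f (e.symm y)) K := fun y hy =>
    ((contDiffAt_comp_symm f he hj (hKe hy)).continuousAt_iteratedFDeriv
      le_rfl).continuousWithinAt
  obtain ⟨B, hB⟩ := hK.exists_bound_of_continuousOn hcont
  refine (TendstoUniformlyOn.congr (F := fun (c : ℝ) y =>
    c • iteratedFDeriv ℝ j (fun y => f (e.symm y)) y) ?_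
    (Eventually.of_forall key)).congr_right (key c)
  rw [Metric.tendstoUniformlyOn_iff]
  intro ε hε
  have h0 : 0 < ε / (|B| + 1) := by positivity
  filter_upwards [Metric.ball_mem_nhds c h0] with c' hc' y hy
  rw [dist_eq_norm, ← sub_smul, norm_smul]
  rw [Metric.mem_ball, dist_comm, dist_eq_norm] at hc'
  calc ‖c - c'‖ * ‖iteratedFDeriv ℝ j (fun y => f (e.symm y)) y‖
      ≤ ‖c - c'‖ * (|B| + 1) := by
        gcongr
        exact (hB y hy).trans ((le_abs_self B).trans (by linarith))
    _ < ε / (|B| + 1) * (|B| + 1) := by gcongr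
    _ = ε := by field_simp

/-- A linear map from a coordinate space to `C^r(M, ℝ)` is continuous. -/
lemma continuous_linearMap_of_pi {N : ℕ}
    (Φ : (Fin N → ℝ) →ₗ[ℝ] C^(r : ℕ∞ω)⟮𝓡 d, M; ℝ⟯) : Continuous Φ := by
  have : ⇑Φ = fun a => ∑ i, a i • Φ (Pi.single i 1) := by
    ext1 a
    conv_lhs => rw [pi_eq_sum_univ' a]
    simp only [map_sum, map_smul]
  rw [this]
  exact continuous_finsetSum _ fun i _ => (continuous_smul_left _).comp (continuous_apply i)

/-- Evaluation is jointly continuous on `C^r(M, ℝ) × M`. -/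
lemma continuous_eval [IsManifold (𝓡 d) (r : ℕ∞ω) M] :
    Continuous fun p : C^(r : ℕ∞ω)⟮𝓡 d, M; ℝ⟯ × M => p.1 p.2 := by
  refine continuous_iff_continuousAt.2 fun ⟨f, x⟩ => ?_
  set e := chartAt (EuclideanSpace ℝ (Fin d)) x with he
  have hx : x ∈ e.source := mem_chart_source _ x
  have hex : e x ∈ e.target := e.map_source hx
  obtain ⟨K, hK, hKe, hKc⟩ := local_compact_nhds (e.open_target.mem_nhds hex)
  -- Only the order-zero part of the topology, uniform convergence on a compact chart neighbourhood,
  -- is used.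
  have h1 := tendsto_crTopology_iff.1 (continuous_fst.continuousAt (x := (f, x))) e
    (IsManifold.chart_mem_maximalAtlas x) 0 (by simp) K hKc hKe
  rw [Metric.tendstoUniformlyOn_iff] at h1
  rw [ContinuousAt, Metric.tendsto_nhds]
  intro ε hε
  have h2 : ∀ᶠ p : C^(r : ℕ∞ω)⟮𝓡 d, M; ℝ⟯ × M in 𝓝 (f, x), p.2 ∈ e.source ∩ e ⁻¹' K :=
    continuous_snd.continuousAt (x := (f, x)) (inter_mem (e.open_source.mem_nhds hx)
      ((e.continuousAt hx).preimage_mem_nhds hK))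
  have h3 : ∀ᶠ p : C^(r : ℕ∞ω)⟮𝓡 d, M; ℝ⟯ × M in 𝓝 (f, x), dist (f p.2) (f x) < ε / 2 :=
    ((f.contMDiff.continuous.comp continuous_snd).continuousAt (x := (f, x)))
      (Metric.ball_mem_nhds (f x) (half_pos hε))
  filter_upwards [h1 (ε / 2) (half_pos hε), h2, h3] with p hp1 hp2 hp3
  have h4 := hp1 (e p.2) hp2.2
  rw [iteratedFDeriv_zero_eq_comp, iteratedFDeriv_zero_eq_comp] at h4
  simp only [Function.comp_apply, LinearIsometryEquiv.dist_map, e.left_inv hp2.1] at h4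
  calc dist (p.1 p.2) (f x) ≤ dist (f p.2) (p.1 p.2) + dist (f p.2) (f x) :=
        dist_triangle_left _ _ _
    _ < ε / 2 + ε / 2 := add_lt_add h4 hp3
    _ = ε := add_halves ε

end CrTopology

/-! ### Prevalence from finite-dimensional probes and Fubini. -/

section Prevalence

open Set Filter
open scoped Topology ENNReal

variable {V : Type*} [TopologicalSpace V]

/-- A Borel set which contains almost every point of each translate of a finite-dimensional
probe is prevalent. -/
lemma isPrevalent_of_probe [Add V] [ContinuousAdd V] {N : ℕ} {Φ : (Fin N → ℝ) → V}
    (hΦ : Continuous Φ) {S B : Set V} (hBS : B ⊆ S) (hB : MeasurableSet[borel V] B)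
    (h : ∀ v, ∀ᵐ a : Fin N → ℝ, v + Φ a ∈ B) : IsPrevalent S := by
  let _ : MeasurableSpace V := borel V
  have _ : BorelSpace V := ⟨rfl⟩
  set ρ : Measure (Fin N → ℝ) := volume.restrict (Metric.closedBall 0 1) with hρ
  refine ⟨B, hBS, hB, ρ.map Φ, ⟨Φ '' Metric.closedBall 0 1,
    (isCompact_closedBall 0 1).image hΦ, ?_, ?_⟩, fun v => ?_⟩
  -- `V` is not assumed Hausdorff, so the compact image may fail to be Borel; the inequality valid
  -- for arbitrary sets is enough.
  · refine lt_of_lt_of_le ?_ (Measure.le_map_apply hΦ.aemeasurable _)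
    refine lt_of_lt_of_le ?_ (measure_mono (subset_preimage_image _ _))
    rw [hρ, Measure.restrict_apply_self]
    exact Metric.measure_closedBall_pos _ _ one_pos
  · refine (measure_mono (subset_univ _)).trans_lt ?_
    rw [Measure.map_apply hΦ.measurable MeasurableSet.univ, preimage_univ, hρ,
      Measure.restrict_apply_univ]
    exact measure_closedBall_lt_top
  · have hv : MeasurableSet {e | v + e ∈ B} := (continuous_const_add v).measurable hB
    rw [ae_map_iff hΦ.aemeasurable hv]
    exact ae_restrict_of_ae (h v)

variable {M : Type*} [EMetricSpace M] [CompactSpace M] [MeasurableSpace M] [BorelSpace M]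
  (μ : Measure M) [IsFiniteMeasure μ]

/-- The measure of the sections of a closed set over a compact space is upper semicontinuous. -/
lemma isOpen_measure_section_lt {G : Set (V × M)} (hG : IsClosed G) (c : ℝ≥0∞) :
    IsOpen {v | μ {x | (v, x) ∈ G} < c} := by
  refine isOpen_iff_mem_nhds.2 fun v hv => ?_
  obtain ⟨U, hGU, hU, hUc⟩ := Set.exists_isOpen_lt_of_lt _ c hv
  -- Projection along the compact space `M` is closed, so the `w` whose section leaves `U` form a
  -- closed set, which misses `v`.
  have hcl : IsClosed (Prod.fst '' (G ∩ Prod.snd ⁻¹' Uᶜ)) :=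
    isClosedMap_fst_of_compactSpace _ (hG.inter (hU.isClosed_compl.preimage continuous_snd))
  have hvG : v ∉ Prod.fst '' (G ∩ Prod.snd ⁻¹' Uᶜ) := by
    rintro ⟨⟨w, x⟩, ⟨hx, hxU⟩, rfl⟩
    exact hxU (hGU hx)
  filter_upwards [hcl.isOpen_compl.mem_nhds hvG] with w hw
  refine (measure_mono fun x hx => ?_).trans_lt hUc
  by_contra hxU
  exact hw ⟨(w, x), ⟨hx, hxU⟩, rfl⟩

/-- The measure of each section is upper semicontinuous in `v`, hence Borel. Since the sections
increase with `n`, the condition says that the supremum of these measures is the total mass. -/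
lemma measurableSet_ae_exists_mem {G : ℕ → Set (V × M)} (hG : ∀ n, IsClosed (G n))
    (hmono : Monotone G) :
    MeasurableSet[borel V] {v | ∀ᵐ x ∂μ, ∃ n, (v, x) ∈ G n} := by
  let _ : MeasurableSpace V := borel V
  have _ : BorelSpace V := ⟨rfl⟩
  have hsec : ∀ n v, IsClosed {x | (v, x) ∈ G n} := fun n v =>
    (hG n).preimage (Continuous.prodMk_right v)
  have hmeas : ∀ n, Measurable fun v => μ {x | (v, x) ∈ G n} := fun n =>
    measurable_of_Iio fun c => (isOpen_measure_section_lt μ (hG n) c).measurableSet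
  have heq : {v | ∀ᵐ x ∂μ, ∃ n, (v, x) ∈ G n} =
      (fun v => ⨆ n, μ {x | (v, x) ∈ G n}) ⁻¹' {μ univ} := by
    ext v
    have hU : {x | ∃ n, (v, x) ∈ G n} = ⋃ n, {x | (v, x) ∈ G n} := by ext; simp
    have hm : Monotone fun n => {x | (v, x) ∈ G n} := fun m n hmn x hx => hmono hmn hx
    rw [mem_preimage, mem_singleton_iff, ← hm.measure_iUnion, ← hU]
    exact ae_iff_measure_eq (hU ▸ (MeasurableSet.iUnion fun n =>
      (hsec n v).measurableSet).nullMeasurableSet)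
  rw [heq]
  exact Measurable.iSup hmeas (measurableSet_singleton _)

/-- A property of `μ`-almost every point, described by an increasing sequence of closed sets, holds
for a prevalent element as soon as at almost every point it holds for almost every element of
each translate of a finite-dimensional probe. -/
theorem isPrevalent_of_ae_probe [Add V] [ContinuousAdd V] {N : ℕ} {Φ : (Fin N → ℝ) → V}
    (hΦ : Continuous Φ) {G : ℕ → Set (V × M)} (hG : ∀ n, IsClosed (G n)) (hmono : Monotone G)
    (h : ∀ v, ∀ᵐ x ∂μ, ∀ᵐ a : Fin N → ℝ, ∃ n, (v + Φ a, x) ∈ G n) {S : Set V}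
    (hS : ∀ v, (∀ᵐ x ∂μ, ∃ n, (v, x) ∈ G n) → v ∈ S) : IsPrevalent S := by
  refine isPrevalent_of_probe hΦ hS (measurableSet_ae_exists_mem μ hG hmono) fun v => ?_
  have hmeas : MeasurableSet {p : M × (Fin N → ℝ) | ∃ n, (v + Φ p.2, p.1) ∈ G n} := by
    rw [ofPred_exists]
    exact MeasurableSet.iUnion fun n => ((hG n).preimage
      ((continuous_const.add (hΦ.comp continuous_snd)).prodMk continuous_fst)).measurableSet
  -- Fubini exchanges "almost every point" with "almost every parameter".
  exact (Measure.ae_ae_comm (p := fun x a => ∃ n, (v + Φ a, x) ∈ G n) hmeas).1 (h v)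

end Prevalence

/-! ### From a Lipschitz bound at `x` to the prediction error. -/

section PredictionError

open Set Filter
open scoped Topology

variable {M : Type*} [TopologicalSpace M] {T : M → M} {h : M → ℝ} {k : ℕ}

lemma continuous_delayMap (hT : Continuous T) (hh : Continuous h) :
    Continuous (delayMap T h k) :=
  (PiLp.continuous_toLp 2 _).comp (continuous_pi fun i => hh.comp (hT.iterate i))

variable [MeasurableSpace M] [BorelSpace M] {μ : Measure M}

lemma delayMap_mem_support_ae (hT : Continuous T) (hh : Continuous h) :
    ∀ᵐ x ∂μ, delayMap T h k x ∈ (Measure.map (delayMap T h k) μ).support :=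
  ae_of_ae_map (continuous_delayMap hT hh).aemeasurable Measure.support_mem_ae

/-- If `φ ∘ T` depends on `φ` in a Lipschitz way at `x`, the prediction error at `φ x` is at most
proportional to the scale. -/
lemma predictionError_le [CompactSpace M] [IsFiniteMeasure μ] (hT : Continuous T)
    (hh : Continuous h) {X : Set M} (hX : μ Xᶜ = 0)
    {x : M} {C : ℝ} (hC : 0 ≤ C)
    (hlip : ∀ y ∈ X, ‖delayMap T h k (T y) - delayMap T h k (T x)‖ ≤
      C * ‖delayMap T h k y - delayMap T h k x‖) {ε : ℝ} (hε : 0 < ε) :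
    predictionError μ T h k ε (delayMap T h k x) ≤ (2 * C) * ε := by
  set P := delayPreimage T h k ε (delayMap T h k x) with hP
  set c := delayMap T h k (T x)
  have hcont := continuous_delayMap (k := k) hT hh
  have hfcont : Continuous fun y => delayMap T h k (T y) := hcont.comp hT
  have hPm : MeasurableSet P := (Metric.isOpen_ball.preimage hcont).measurableSet
  have hint : Integrable (fun y => delayMap T h k (T y)) (μ.restrict P) :=
    hfcont.integrable_of_hasCompactSupport (HasCompactSupport.of_compactSpace _)
  have hPb : ∀ᵐ y ∂μ.restrict P, ‖delayMap T h k (T y) - c‖ ≤ C * ε := by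
    have hXae : ∀ᵐ y ∂μ, y ∈ X := hX
    filter_upwards [ae_restrict_mem hPm, ae_restrict_of_ae hXae] with y hyP hyX
    refine (hlip y hyX).trans (mul_le_mul_of_nonneg_left ?_ hC)
    exact (mem_ball_iff_norm.1 hyP).le
  -- If `P` is null, the convention `0⁻¹ = 0` makes the error zero.
  rcases eq_or_ne (μ.real P) 0 with h0 | h0
  · rw [predictionError, ← hP, h0, inv_zero, zero_mul, Real.sqrt_zero]
    positivity
  have hpos : 0 < μ.real P := lt_of_le_of_ne measureReal_nonneg h0.symm
  -- The mean of vectors within `C * ε` of `c` is itself within `C * ε` of `c`; passing from `c` to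
  -- the mean costs the factor `2`.
  have hmean : ‖meanPrediction μ T h k ε (delayMap T h k x) - c‖ ≤ C * ε := by
    have h1 : meanPrediction μ T h k ε (delayMap T h k x) - c =
        (μ.real P)⁻¹ • ∫ y in P, (delayMap T h k (T y) - c) ∂μ := by
      rw [integral_sub hint (integrable_const c), smul_sub, setIntegral_const, smul_smul,
        inv_mul_cancel₀ h0, one_smul, meanPrediction]
    rw [h1, norm_smul, Real.norm_of_nonneg (inv_nonneg.2 hpos.le), inv_mul_le_iff₀ hpos]
    calc ‖∫ y in P, (delayMap T h k (T y) - c) ∂μ‖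
        ≤ C * ε * (μ.restrict P).real univ := norm_integral_le_of_norm_le_const hPb
      _ = μ.real P * (C * ε) := by rw [measureReal_restrict_apply_univ, mul_comm]
  set m := meanPrediction μ T h k ε (delayMap T h k x)
  refine Real.sqrt_le_iff.2 ⟨by positivity, ?_⟩
  rw [inv_mul_le_iff₀ hpos]
  calc ∫ y in P, ‖delayMap T h k (T y) - m‖ ^ 2 ∂μ
      ≤ ‖∫ y in P, ‖delayMap T h k (T y) - m‖ ^ 2 ∂μ‖ := Real.le_norm_self _
    _ ≤ (2 * C * ε) ^ 2 * (μ.restrict P).real univ := by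
      refine norm_integral_le_of_norm_le_const (hPb.mono fun y hy => ?_)
      rw [norm_pow, norm_norm]
      gcongr
      calc ‖delayMap T h k (T y) - m‖
          ≤ ‖delayMap T h k (T y) - c‖ + ‖m - c‖ := by
            rw [← sub_sub_sub_cancel_right _ m c]; exact norm_sub_le _ _
        _ ≤ 2 * C * ε := by linarith
    _ = μ.real P * (2 * C * ε) ^ 2 := by rw [measureReal_restrict_apply_univ, mul_comm]

end PredictionError

/-! ### Images of Hausdorff null sets under `C^1` maps. -/

section NullImage

open Set Filter
open scoped Topology NNReal

variable {d : ℕ} {M : Type*} [EMetricSpace M] [ChartedSpace (EuclideanSpace ℝ (Fin d)) M]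
  [IsManifold (𝓡 d) 1 M] [Bundle.RiemannianBundle (fun x : M => TangentSpace (𝓡 d) x)]
  [IsContinuousRiemannianBundle (EuclideanSpace ℝ (Fin d))
    (fun x : M => TangentSpace (𝓡 d) x)]
  [IsRiemannianManifold (𝓡 d) M]
  {F : Type*} [NormedAddCommGroup F] [NormedSpace ℝ F]

/-- A `C^1` map is locally Lipschitz for the Riemannian distance. -/
lemma exists_lipschitzOnWith_of_contMDiffAt {f : M → F} {x : M}
    (hf : ContMDiffAt (𝓡 d) 𝓘(ℝ, F) 1 f x) : ∃ C : ℝ≥0, ∃ u ∈ 𝓝 x, LipschitzOnWith C f u := by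
  have h1 := (contMDiffAt_iff.1 hf).2
  simp only [extChartAt_model_space_eq_id, PartialEquiv.refl_coe, Function.id_comp,
    modelWithCornersSelf_coe, range_id, contDiffWithinAt_univ] at h1
  obtain ⟨K, t, ht, hK⟩ := h1.exists_lipschitzOnWith
  obtain ⟨C, u, hu, hC⟩ := exists_lipschitzOnWith_extChartAt (𝓡 d) x
  refine ⟨K * C, u ∩ (extChartAt (𝓡 d) x ⁻¹' t ∩ (extChartAt (𝓡 d) x).source),
    inter_mem hu (inter_mem ((continuousAt_extChartAt x).preimage_mem_nhds ht)
      (extChartAt_source_mem_nhds x)), ?_⟩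
  have h2 := hK.comp (hC.mono (inter_subset_left
    (t := extChartAt (𝓡 d) x ⁻¹' t ∩ (extChartAt (𝓡 d) x).source))) fun y hy => hy.2.1
  refine fun y hy z hz => ?_
  have h3 := h2 hy hz
  simpa only [Function.comp_apply, (extChartAt (𝓡 d) x).left_inv hy.2.2,
    (extChartAt (𝓡 d) x).left_inv hz.2.2] using h3

/-- A `C^1` map sends `k`-dimensional Hausdorff null sets to null sets. -/
theorem hausdorffMeasure_image_eq_zero [SecondCountableTopology M] [MeasurableSpace M]
    [BorelSpace M] [MeasurableSpace F] [BorelSpace F]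
    {X U : Set M} {f : M → F} (hf : ∀ x ∈ U, ContMDiffAt (𝓡 d) 𝓘(ℝ, F) 1 f x) {k : ℝ}
    (hk : 0 ≤ k) (hX : μH[k] X = 0) : μH[k] (f '' (X ∩ U)) = 0 := by
  choose! C u hu hC using fun x hx => exists_lipschitzOnWith_of_contMDiffAt (hf x hx)
  obtain ⟨t, htU, ht, hcov⟩ := TopologicalSpace.countable_cover_nhdsWithin
    (f := u) (s := U) fun x hx => mem_nhdsWithin_of_mem_nhds (hu x hx)
  have hsub : f '' (X ∩ U) ⊆ ⋃ x ∈ t, f '' (X ∩ u x) := by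
    rintro _ ⟨y, ⟨hyX, hyU⟩, rfl⟩
    obtain ⟨x, hx, hyx⟩ := mem_iUnion₂.1 (hcov hyU)
    exact mem_iUnion₂.2 ⟨x, hx, y, ⟨hyX, hyx⟩, rfl⟩
  refine measure_mono_null hsub ((measure_biUnion_null_iff ht).2 fun x hx => ?_)
  have h1 := ((hC x (htU hx)).mono (inter_subset_right (s := X))).hausdorffMeasure_image_le hk
  rw [measure_mono_null inter_subset_left hX, mul_zero] at h1
  exact le_antisymm h1 bot_le

end NullImage

/-! ### Construction of the finite-dimensional probe. -/

section Probe

open Set Filter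
open scoped Topology

variable {d : ℕ} {M : Type*} [TopologicalSpace M] [ChartedSpace (EuclideanSpace ℝ (Fin d)) M]
  {r : ℕ∞}

/-- The powers of a finite-dimensional subspace of an algebra which contains `1` form an increasing
filtration by finite-dimensional subspaces. -/
lemma exists_fg_filtration {A : Type*} [CommRing A] [Algebra ℝ A] {V : Submodule ℝ A} (hV : V.FG)
    (h1 : 1 ∈ V) : ∃ W : ℕ → Submodule ℝ A, (∀ n, (W n).FG) ∧ Monotone W ∧ 1 ∈ W 0 ∧ V ≤ W 1 ∧
      ∀ m n, ∀ a ∈ W m, ∀ b ∈ W n, a * b ∈ W (m + n) :=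
  ⟨fun n => V ^ n, fun n => hV.pow n, pow_right_mono₀ (Submodule.one_le.2 h1),
    by simp [Submodule.one_le.1 le_rfl], by simp, fun m n a ha b hb => by
      simpa only [pow_add] using Submodule.mul_mem_mul ha hb⟩

/-- A function with compact support in the target of a chart extends by zero to the manifold. -/
lemma contMDiff_indicator_chart [T2Space M]
    {e : OpenPartialHomeomorph M (EuclideanSpace ℝ (Fin d))}
    (he : e ∈ IsManifold.maximalAtlas (𝓡 d) (r : ℕ∞ω) M) {F : EuclideanSpace ℝ (Fin d) → ℝ}
    (hF : ContDiff ℝ (r : ℕ∞ω) F) (hc : HasCompactSupport F) (hs : tsupport F ⊆ e.target) :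
    ContMDiff (𝓡 d) 𝓘(ℝ, ℝ) (r : ℕ∞ω) (e.source.indicator fun x => F (e x)) := by
  have hcl : IsClosed (e.symm '' tsupport F) :=
    (hc.isCompact.image_of_continuousOn (e.continuousOn_symm.mono hs)).isClosed
  have hsub : tsupport (e.source.indicator fun x => F (e x)) ⊆ e.symm '' tsupport F := by
    refine closure_minimal (fun x hx => ?_) hcl
    obtain ⟨hxe, hx⟩ := Set.indicator_apply_ne_zero.1 hx
    exact ⟨e x, subset_tsupport F hx, e.left_inv hxe⟩
  refine contMDiff_of_tsupport fun x hx => ?_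
  obtain ⟨y, hy, rfl⟩ := hsub hx
  have hye : e.symm y ∈ e.source := e.map_target (hs hy)
  refine (hF.contMDiff.contMDiffAt.comp _
    (contMDiffAt_of_mem_maximalAtlas he hye)).congr_of_eventuallyEq ?_
  filter_upwards [e.open_source.mem_nhds hye] with z hz
  exact Set.indicator_of_mem hz _

/-- Near each point, a bump function and its products with the chart coordinates are globally
defined functions of class `C^r`. -/
lemma exists_bump_coordinates [T2Space M] [IsManifold (𝓡 d) (r : ℕ∞ω) M] (p : M) :
    ∃ (b : C^(r : ℕ∞ω)⟮𝓡 d, M; ℝ⟯) (c : Fin d → C^(r : ℕ∞ω)⟮𝓡 d, M; ℝ⟯),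
      (∀ᶠ x in 𝓝 p, b x = 1) ∧
      (∀ x, b x ≠ 0 → x ∈ (chartAt (EuclideanSpace ℝ (Fin d)) p).source) ∧
      ∀ j x, c j x = b x * (chartAt (EuclideanSpace ℝ (Fin d)) p x) j := by
  set e := chartAt (EuclideanSpace ℝ (Fin d)) p
  have he : e ∈ IsManifold.maximalAtlas (𝓡 d) (r : ℕ∞ω) M := IsManifold.chart_mem_maximalAtlas p
  have hp : p ∈ e.source := mem_chart_source _ p
  obtain ⟨ρ, hρ, hball⟩ := Metric.nhds_basis_closedBall.mem_iff.1
    (e.open_target.mem_nhds (e.map_source hp))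
  let φ : ContDiffBump (e p) := ⟨ρ / 2, ρ, by positivity, by linarith⟩
  have hts : tsupport φ ⊆ e.target := by rw [φ.tsupport_eq]; exact hball
  have hb := contMDiff_indicator_chart he (φ.contDiff (n := r)) φ.hasCompactSupport hts
  have hc : ∀ j : Fin d, ContMDiff (𝓡 d) 𝓘(ℝ, ℝ) (r : ℕ∞ω)
      (e.source.indicator fun x => φ (e x) * (e x) j) := fun j =>
    contMDiff_indicator_chart (F := fun y => φ y * y j) he
      (φ.contDiff.mul (EuclideanSpace.proj (𝕜 := ℝ) j).contDiff)
      φ.hasCompactSupport.mul_right ((tsupport_mul_subset_left).trans hts)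
  refine ⟨⟨_, hb⟩, fun j => ⟨_, hc j⟩, ?_,
    fun x hx => by_contra fun h => hx (Set.indicator_of_notMem (f := fun x => φ (e x)) h),
    fun j x => ?_⟩
  · filter_upwards [e.open_source.mem_nhds hp,
      (e.continuousAt hp).preimage_mem_nhds (Metric.closedBall_mem_nhds (e p) φ.rIn_pos)]
      with x hx hxb
    exact (Set.indicator_of_mem (f := fun x => φ (e x)) hx).trans (φ.one_of_mem_closedBall hxb)
  · exact Set.indicator_mul_left e.source (fun x => φ (e x)) fun x => (e x) j

/-- On a compact manifold there is a finite-dimensional space of functions of class `C^r` which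
contains the constants, separates points and, near each point, contains all linear functions of
some chart. -/
theorem exists_fg_separating [T2Space M] [CompactSpace M] [IsManifold (𝓡 d) (r : ℕ∞ω) M] :
    ∃ V : Submodule ℝ C^(r : ℕ∞ω)⟮𝓡 d, M; ℝ⟯, V.FG ∧ 1 ∈ V ∧
      (∀ x y, x ≠ y → ∃ u ∈ V, u x ≠ u y) ∧
      ∀ x, ∃ e ∈ IsManifold.maximalAtlas (𝓡 d) (r : ℕ∞ω) M, x ∈ e.source ∧
        ∀ j : Fin d, ∃ u ∈ V, ∀ᶠ y in 𝓝 x, u y = e y j := by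
  choose b c hb hbs hc using exists_bump_coordinates (d := d) (M := M) (r := r)
  obtain ⟨t, ht⟩ := CompactSpace.elim_nhds_subcover (fun p => interior {x | b p x = 1})
    fun p => interior_mem_nhds.2 (hb p)
  have hcov : ∀ x, ∃ p ∈ t, ∀ᶠ y in 𝓝 x, b p y = 1 := fun x => by
    have hx : x ∈ (⊤ : Set M) := mem_univ x
    rw [← ht] at hx
    obtain ⟨p, hp, hx⟩ := mem_iUnion₂.1 hx
    exact ⟨p, hp, mem_interior_iff_mem_nhds.1 hx⟩
  set s : Set C^(r : ℕ∞ω)⟮𝓡 d, M; ℝ⟯ := {1} ∪ ⋃ p ∈ t, ({b p} ∪ range (c p))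
  have hbV : ∀ p ∈ t, b p ∈ Submodule.span ℝ s := fun p hp =>
    Submodule.subset_span (Or.inr (mem_iUnion₂.2 ⟨p, hp, Or.inl rfl⟩))
  have hcV : ∀ p ∈ t, ∀ j, c p j ∈ Submodule.span ℝ s := fun p hp j =>
    Submodule.subset_span (Or.inr (mem_iUnion₂.2 ⟨p, hp, Or.inr ⟨j, rfl⟩⟩))
  refine ⟨Submodule.span ℝ s, Submodule.fg_span ?_, Submodule.subset_span (Or.inl rfl),
    fun x y hxy => ?_, fun x => ?_⟩
  · exact (finite_singleton _).union (t.finite_toSet.biUnion fun p _ =>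
      (finite_singleton _).union (finite_range _))
  · obtain ⟨p, hp, hx⟩ := hcov x
    have hx1 := hx.self_of_nhds
    -- If the bump is `1` at both points, the cut-off coordinates are the chart coordinates there
    -- and one of them separates; otherwise the bump does.
    by_cases hy1 : b p y = 1
    · by_contra! hall
      refine hxy ((chartAt (EuclideanSpace ℝ (Fin d)) p).injOn (hbs p x (by simp [hx1]))
        (hbs p y (by simp [hy1])) ?_)
      ext j
      have := hall _ (hcV p hp j)
      simpa [hc, hx1, hy1] using this
    · exact ⟨b p, hbV p hp, fun h => hy1 (h ▸ hx1)⟩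
  · obtain ⟨p, hp, hx⟩ := hcov x
    refine ⟨_, IsManifold.chart_mem_maximalAtlas p, hbs p x (by simp [hx.self_of_nhds]), fun j =>
      ⟨_, hcV p hp j, hx.mono fun y hy => by simp [hc, hy]⟩⟩

/-- Composition with a `C^r` self-map, as a linear map on `C^r(M, ℝ)`. -/
noncomputable def pullback (g : C^(r : ℕ∞ω)⟮𝓡 d, M; 𝓡 d, M⟯) :
    C^(r : ℕ∞ω)⟮𝓡 d, M; ℝ⟯ →ₗ[ℝ] C^(r : ℕ∞ω)⟮𝓡 d, M; ℝ⟯ where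
  toFun f := f.comp g
  map_add' _ _ := rfl
  map_smul' _ _ := rfl

lemma contMDiff_iterate {S : M → M} (hS : ContMDiff (𝓡 d) (𝓡 d) (r : ℕ∞ω) S) (n : ℕ) :
    ContMDiff (𝓡 d) (𝓡 d) (r : ℕ∞ω) S^[n] := by
  induction n with
  | zero => exact contMDiff_id
  | succ n ih => exact ih.comp hS

/-- Interpolation at finitely many points by products of functions from a space which contains the
constants and separates points. -/
lemma exists_mem_filtration_interpolate {W : ℕ → Submodule ℝ C^(r : ℕ∞ω)⟮𝓡 d, M; ℝ⟯}
    (h0 : 1 ∈ W 0) (h1 : 1 ∈ W 1) (hmul : ∀ m n, ∀ a ∈ W m, ∀ b ∈ W n, a * b ∈ W (m + n))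
    (hsep : ∀ x y, x ≠ y → ∃ u ∈ W 1, u x ≠ u y) (p : M) (s : Finset M) (hp : p ∉ s) :
    ∃ g ∈ W s.card, g p = 1 ∧ ∀ q ∈ s, g q = 0 := by
  classical
  induction s using Finset.induction_on with
  | empty => exact ⟨1, h0, rfl, by simp⟩
  | insert q s hq ih =>
    obtain ⟨g, hg, hgp, hgs⟩ := ih fun h => hp (Finset.mem_insert_of_mem h)
    obtain ⟨u, hu, hupq⟩ := hsep p q fun h => hp (h ▸ Finset.mem_insert_self _ _)
    have hne : u p - u q ≠ 0 := sub_ne_zero.2 hupq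
    -- The new factor `(u - u q) / (u p - u q)` is `1` at `p` and `0` at `q`; it raises the degree
    -- by one.
    refine ⟨g * ((u p - u q)⁻¹ • (u - u q • 1)), ?_, ?_, fun q' hq' => ?_⟩
    · rw [Finset.card_insert_of_notMem hq]
      exact hmul _ _ _ hg _ ((W 1).smul_mem _ ((W 1).sub_mem hu ((W 1).smul_mem _ h1)))
    · change g p * ((u p - u q)⁻¹ * (u p - u q * 1)) = 1
      rw [hgp, mul_one, one_mul, inv_mul_cancel₀ hne]
    · change g q' * ((u p - u q)⁻¹ * (u q' - u q * 1)) = 0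
      rcases Finset.mem_insert.1 hq' with rfl | hq'
      · simp
      · simp [hgs q' hq']

/-- The derivative of `w² f` is `2 w f w' + w² f'`. Where `w = 0` it vanishes whatever `f` is, which
a single factor `w` would not ensure; where `w = 1` and `f = 0` it is `f'`. This allows derivatives
to be prescribed independently along an orbit. -/
lemma hasFDerivAt_iterate_symm_mul_mul (hr : 1 ≤ r) {S : M → M}
    (hS : ContMDiff (𝓡 d) (𝓡 d) (r : ℕ∞ω) S)
    {e : OpenPartialHomeomorph M (EuclideanSpace ℝ (Fin d))}
    (he : e ∈ IsManifold.maximalAtlas (𝓡 d) (r : ℕ∞ω) M) {x : M} (hx : x ∈ e.source)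
    (w f : C^(r : ℕ∞ω)⟮𝓡 d, M; ℝ⟯) {L : EuclideanSpace ℝ (Fin d) →L[ℝ] ℝ}
    (hL : w (S x) = 0 ∧ L = 0 ∨ w (S x) = 1 ∧ f (S x) = 0 ∧
      HasFDerivAt (fun y => f (S (e.symm y))) L (e x)) :
    HasFDerivAt (fun y => (w * w * f) (S (e.symm y))) L (e x) := by
  have hdiff : ∀ g : C^(r : ℕ∞ω)⟮𝓡 d, M; ℝ⟯,
      DifferentiableAt ℝ (fun y => g (S (e.symm y))) (e x) := fun g =>
    (contDiffAt_comp_symm (pullback ⟨S, hS⟩ g) he (j := 1) (by exact_mod_cast hr)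
      (e.map_source hx)).differentiableAt (by simp)
  have hw := (hdiff w).hasFDerivAt
  have hex : e.symm (e x) = x := e.left_inv hx
  rcases hL with ⟨h0, rfl⟩ | ⟨h1, hf, hfL⟩
  · have := (hw.mul hw).mul (hdiff f).hasFDerivAt
    exact this.congr_fderiv (by simp [hex, h0])
  · have := (hw.mul hw).mul hfL
    exact this.congr_fderiv (by simp [hex, h1, hf])

/-- A finite-dimensional space of observables which interpolates at `2 k` points and, when
`d ≤ k`, contains near each orbit of length `k` an observable whose delay map is an immersion. -/
theorem exists_probe [T2Space M] [CompactSpace M] [IsManifold (𝓡 d) (r : ℕ∞ω) M] (hr : 1 ≤ r)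
    (T : Diffeomorph (𝓡 d) (𝓡 d) M M (r : ℕ∞ω)) {k : ℕ} (hk : 0 < k) (hdk : d ≤ k) :
    ∃ V : Submodule ℝ C^(r : ℕ∞ω)⟮𝓡 d, M; ℝ⟯, V.FG ∧
      (∀ (p : M) (s : Finset M), p ∉ s → s.card < 2 * k →
        ∃ g ∈ V, g p = 1 ∧ ∀ q ∈ s, g q = 0) ∧
      ∀ x, InjOn (fun i => T^[i] x) (Iio k) →
        ∃ e ∈ IsManifold.maximalAtlas (𝓡 d) (r : ℕ∞ω) M, x ∈ e.source ∧
          ∃ g ∈ V, ∃ L : EuclideanSpace ℝ (Fin d) →L[ℝ] (Fin k → ℝ), Function.Injective L ∧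
            HasFDerivAt (fun y (i : Fin k) => g (T^[i] (e.symm y))) L (e x) := by
  classical
  obtain ⟨V₀, hfg, h1, hsep, hcoord⟩ := exists_fg_separating (d := d) (M := M) (r := r)
  set S : ℕ → C^(r : ℕ∞ω)⟮𝓡 d, M; 𝓡 d, M⟯ := fun i =>
    ⟨T.symm^[i], contMDiff_iterate T.symm.contMDiff i⟩
  have hST : ∀ i x, S i (T^[i] x) = x := fun i =>
    (T.toEquiv.left_inv : Function.LeftInverse _ _).iterate i
  -- Pulling back by `T⁻ⁱ` makes the `i`-th delay coordinate of `u ∘ T⁻ⁱ` equal to `u` itself.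
  set V : Submodule ℝ C^(r : ℕ∞ω)⟮𝓡 d, M; ℝ⟯ := ⨆ i ∈ Finset.range k, V₀.map (pullback (S i))
  have hVmem : ∀ i < k, ∀ u ∈ V₀, pullback (S i) u ∈ V := fun i hi u hu =>
    Submodule.mem_iSup_of_mem i (Submodule.mem_iSup_of_mem (Finset.mem_range.2 hi)
      (Submodule.mem_map_of_mem hu))
  have hV₀ : ∀ u ∈ V₀, u ∈ V := fun u hu => hVmem 0 hk u hu
  have hV1 : 1 ∈ V := hV₀ 1 h1
  have hVfg : V.FG := Submodule.fg_biSup _ _ fun i _ => hfg.map _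
  obtain ⟨W, hWfg, hWmono, hW0, hVW, hmul⟩ := exists_fg_filtration hVfg hV1
  have hWsep : ∀ x y, x ≠ y → ∃ u ∈ W 1, u x ≠ u y := fun x y hxy =>
    let ⟨u, hu, h⟩ := hsep x y hxy
    ⟨u, hVW (hV₀ u hu), h⟩
  have hinterp := exists_mem_filtration_interpolate hW0 (hVW hV1) hmul hWsep
  refine ⟨W (2 * k), hWfg _, fun p s hp hs => ?_, fun x hx => ?_⟩
  · obtain ⟨g, hg, h⟩ := hinterp p s hp
    exact ⟨g, hWmono hs.le hg, h⟩
  obtain ⟨e, he, hxe, hlin⟩ := hcoord x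
  choose u huV hu using hlin
  refine ⟨e, he, hxe, ?_⟩
  -- Cut-offs selecting one point of the orbit segment; excluding the other `k - 1` points takes
  -- degree `k - 1`.
  have hw : ∀ i : Fin d, ∃ w ∈ W (k - 1), w (T^[i] x) = 1 ∧
      ∀ l < k, l ≠ i → w (T^[l] x) = 0 := fun i => by
    have hi : (i : ℕ) < k := i.2.trans_le hdk
    have hnot : T^[i] x ∉ ((Finset.range k).erase i).image fun l => T^[l] x := fun h => by
      obtain ⟨l, hl, hlx⟩ := Finset.mem_image.1 h
      obtain ⟨hli, hl⟩ := Finset.mem_erase.1 hl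
      exact hli (hx (Finset.mem_range.1 hl) hi hlx)
    obtain ⟨w, hw, hwp, hws⟩ := hinterp (T^[i] x) _ hnot
    refine ⟨w, hWmono ?_ hw, hwp, fun l hl hli => hws _
      (Finset.mem_image_of_mem _ (Finset.mem_erase.2 ⟨hli, Finset.mem_range.2 hl⟩))⟩
    refine Finset.card_image_le.trans ?_
    rw [Finset.card_erase_of_mem (Finset.mem_range.2 hi), Finset.card_range]
  choose w hwV hw1 hw0 using hw
  set f : Fin d → C^(r : ℕ∞ω)⟮𝓡 d, M; ℝ⟯ := fun i => pullback (S i) (u i - u i x • 1)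
  have hfV : ∀ i, f i ∈ V := fun i =>
    hVmem i (i.2.trans_le hdk) _ (V₀.sub_mem (huV i) (V₀.smul_mem _ h1))
  have hfT : ∀ i z, f i (T^[i] z) = u i z - u i x := fun i z => by
    change u i (S i (T^[i] z)) - u i x * 1 = _
    rw [hST, mul_one]
  set g : C^(r : ℕ∞ω)⟮𝓡 d, M; ℝ⟯ := ∑ i, w i * w i * f i
  have hgV : g ∈ W (2 * k) := Submodule.sum_mem _ fun i _ =>
    hWmono (by omega : k - 1 + (k - 1) + 1 ≤ 2 * k)
      (hmul _ _ _ (hmul _ _ _ (hwV i) _ (hwV i)) _ (hVW (hfV i)))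
  -- At `T^l x` only the term `i = l` contributes, so the first `d` delay coordinates of `g` have
  -- the chart coordinates as derivatives. This gives injectivity.
  have hderiv : ∀ l : Fin d, HasFDerivAt (fun y => g (T^[l] (e.symm y)))
      (EuclideanSpace.proj (𝕜 := ℝ) l) (e x) := fun l => by
    have h3 : ∀ i : Fin d, HasFDerivAt (fun y => (w i * w i * f i) (T^[l] (e.symm y)))
        (if i = l then EuclideanSpace.proj (𝕜 := ℝ) l else 0) (e x) := fun i => by
      refine hasFDerivAt_iterate_symm_mul_mul hr (contMDiff_iterate T.contMDiff l) he hxe _ _ ?_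
      split_ifs with hil
      · subst hil
        refine Or.inr ⟨hw1 i, by rw [hfT, sub_self], ?_⟩
        have h4 : HasFDerivAt (fun y : EuclideanSpace ℝ (Fin d) => y i - u i x)
            (EuclideanSpace.proj (𝕜 := ℝ) i) (e x) :=
          (EuclideanSpace.proj (𝕜 := ℝ) i).hasFDerivAt.sub_const _
        refine h4.congr_of_eventuallyEq ?_
        filter_upwards [(e.tendsto_symm hxe).eventually (hu i),
          e.open_target.mem_nhds (e.map_source hxe)] with y hy hyt
        rw [hfT, hy, e.right_inv hyt]
      · exact Or.inl ⟨hw0 i l (l.2.trans_le hdk) fun h => hil (Fin.ext h.symm), rfl⟩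
    have h5 := HasFDerivAt.fun_sum (u := Finset.univ) fun i _ => h3 i
    rw [Finset.sum_ite_eq' Finset.univ l, if_pos (Finset.mem_univ l)] at h5
    refine h5.congr_of_eventuallyEq (Eventually.of_forall fun y => ?_)
    exact (congrFun (map_sum (ContMDiffMap.coeFnLinearMap (𝕜 := ℝ)) (fun i => w i * w i * f i)
      Finset.univ) _).trans (Finset.sum_apply _ _ _)
  have hdiff : ∀ l : Fin k, DifferentiableAt ℝ (fun y => g (T^[l] (e.symm y))) (e x) := fun l =>
    (contDiffAt_comp_symm (pullback ⟨T^[l], contMDiff_iterate T.contMDiff l⟩ g) he (j := 1)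
      (by exact_mod_cast hr) (e.map_source hxe)).differentiableAt (by simp)
  refine ⟨g, hgV, ContinuousLinearMap.pi fun l => fderiv ℝ (fun y => g (T^[l] (e.symm y))) (e x),
    ?_, hasFDerivAt_pi.2 fun l => (hdiff l).hasFDerivAt⟩
  refine (injective_iff_map_eq_zero _).2 fun v hv => ?_
  ext l
  have h6 := congrFun hv ⟨l, l.2.trans_le hdk⟩
  rw [ContinuousLinearMap.pi_apply, (hderiv l).fderiv] at h6
  exact h6

end Probe

/-! ### Generic injectivity in affine families of linear maps. -/

section LinearAlgebra

open Set Filter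
open scoped Topology

/-- If some element of a finite-dimensional family of linear maps is injective, then almost every
element of each affine translate of the family is injective. -/
lemma ae_injective_add {E F : Type*} [NormedAddCommGroup E] [NormedSpace ℝ E]
    [FiniteDimensional ℝ E] [NormedAddCommGroup F] [NormedSpace ℝ F] {N : ℕ} (A : E →L[ℝ] F)
    (B : (Fin N → ℝ) →ₗ[ℝ] E →L[ℝ] F) {a₀ : Fin N → ℝ} (ha₀ : Function.Injective (B a₀)) :
    ∀ᵐ a : Fin N → ℝ, Function.Injective (A + B a) := by
  have hopen : IsOpen {a : Fin N → ℝ | Function.Injective (A + B a)} :=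
    ContinuousLinearMap.isOpen_injective.preimage
      (continuous_const.add B.continuous_of_finiteDimensional)
  -- By Fubini along lines parallel to `a₀`, it suffices to treat `A + B b + t • B a₀` for almost
  -- every real `t`.
  refine ae_mem_of_ae_add_linearMap_mem (LinearMap.toSpanSingleton ℝ _ a₀) volume volume
    hopen.measurableSet fun b => ?_
  -- With `P` a left inverse of `B a₀`, a nonzero kernel vector at time `t` is an eigenvector of `P
  -- ∘ (A + B b)` for `-t`; only finitely many `t` are excluded.
  obtain ⟨P, hP⟩ := (B a₀ : E →ₗ[ℝ] F).exists_leftInverse_of_injective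
    (LinearMap.ker_eq_bot.2 ha₀)
  set Q : Module.End ℝ E := P ∘ₗ ((A + B b : E →L[ℝ] F) : E →ₗ[ℝ] F)
  have hfin : {t : ℝ | Q.HasEigenvalue (-t)}.Finite :=
    Q.finite_hasEigenvalue.preimage neg_injective.injOn
  filter_upwards [compl_mem_ae_iff.2 (hfin.measure_zero volume)] with t ht
  refine (injective_iff_map_eq_zero _).2 fun v hv => by_contra fun hv0 => ht ?_
  have hv' : (A + B b) v = -(t • B a₀ v) := by
    rw [eq_neg_iff_add_eq_zero, ← hv]
    simp [add_assoc]
  refine Module.End.hasEigenvalue_of_hasEigenvector (x := v)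
    ⟨Module.End.mem_eigenspace_iff.2 ?_, hv0⟩
  have h1 : P (B a₀ v) = v := LinearMap.congr_fun hP v
  change P ((A + B b) v) = -t • v
  rw [hv', map_neg, map_smul, h1, neg_smul]

end LinearAlgebra

/-! ### Lipschitz dependence at a point from separation and immersion. -/

section LocalEstimate

open Set Filter
open scoped Topology

/-- If `φ` separates `x` from the other points of a compact set `X` and is an immersion at `x`,
then functions differentiable at `x` are Lipschitz at `x` with respect to `φ`. -/
lemma exists_forall_norm_sub_le {M E F F' : Type*} [TopologicalSpace M] [NormedAddCommGroup E]
    [NormedSpace ℝ E] [FiniteDimensional ℝ E] [NormedAddCommGroup F] [NormedSpace ℝ F]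
    [NormedAddCommGroup F'] [NormedSpace ℝ F']
    {φ : M → F} {ψ : M → F'} (hφ : Continuous φ) (hψ : Continuous ψ) {X : Set M}
    (hX : IsCompact X) {x : M} (hsep : ∀ y ∈ X, y ≠ x → φ y ≠ φ x)
    (e : OpenPartialHomeomorph M E) (hx : x ∈ e.source) {L : E →L[ℝ] F}
    (hL : Function.Injective L) (hφL : HasFDerivAt (fun y => φ (e.symm y)) L (e x))
    (hψd : DifferentiableAt ℝ (fun y => ψ (e.symm y)) (e x)) :
    ∃ n : ℕ, ∀ y ∈ X, ‖ψ y - ψ x‖ ≤ n * ‖φ y - φ x‖ := by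
  suffices h : ∃ C : ℝ, ∀ y ∈ X, ‖ψ y - ψ x‖ ≤ C * ‖φ y - φ x‖ by
    obtain ⟨C, hC⟩ := h
    obtain ⟨n, hn⟩ := exists_nat_ge C
    exact ⟨n, fun y hy => (hC y hy).trans (by gcongr)⟩
  -- Compactness reduces the bound to neighbourhoods: near `x` it comes from the immersion,
  -- elsewhere from continuity and `φ y ≠ φ x`.
  refine hX.induction_on (p := fun s => ∃ C : ℝ, ∀ y ∈ s, ‖ψ y - ψ x‖ ≤ C * ‖φ y - φ x‖)
    ⟨0, by simp⟩ (fun s t hst ⟨C, hC⟩ => ⟨C, fun y hy => hC y (hst hy)⟩)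
    (fun s t ⟨C, hC⟩ ⟨C', hC'⟩ => ⟨max C C', ?_⟩) fun y hy => ?_
  · rintro y (hy | hy)
    · exact (hC y hy).trans (by gcongr; exact le_max_left _ _)
    · exact (hC' y hy).trans (by gcongr; exact le_max_right _ _)
  by_cases hyx : y = x
  · subst hyx
    obtain ⟨K, -, hK⟩ := (L : E →ₗ[ℝ] F).exists_antilipschitzWith (LinearMap.ker_eq_bot.2 hL)
    -- The increment of `ψ` is `O` of the chart increment, which is `O` of the increment of `φ`
    -- because `L` is bounded below.
    have h1 := hψd.hasFDerivAt.isBigO_sub.trans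
      (hφL.isThetaTVS_sub (hK.isUniformInducing L.uniformContinuous).isInducing).2.isBigO
    obtain ⟨C, hC⟩ := h1.bound
    refine ⟨_, mem_nhdsWithin_of_mem_nhds (inter_mem ((e.continuousAt hx).eventually hC)
      (e.open_source.mem_nhds hx)), C, fun z hz => ?_⟩
    have h2 : ‖ψ (e.symm (e z)) - ψ (e.symm (e y))‖ ≤ C * ‖φ (e.symm (e z)) - φ (e.symm (e y))‖ :=
      hz.1
    rwa [e.left_inv hx, e.left_inv hz.2] at h2
  · have hpos : 0 < ‖φ y - φ x‖ := norm_pos_iff.2 (sub_ne_zero.2 (hsep y hy hyx))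
    obtain ⟨C, hC⟩ := exists_gt (‖ψ y - ψ x‖ / ‖φ y - φ x‖)
    rw [div_lt_iff₀ hpos] at hC
    have h2 : ∀ᶠ z in 𝓝 y, ‖ψ z - ψ x‖ < C * ‖φ z - φ x‖ :=
      ((hψ.sub continuous_const).norm.continuousAt).eventually_lt
        (continuous_const.mul (hφ.sub continuous_const).norm).continuousAt hC
    exact ⟨_, mem_nhdsWithin_of_mem_nhds h2, C, fun z hz => le_of_lt hz⟩

end LocalEstimate

/-! ### Differences of delay vectors and separation of two points. -/

section Separation

open Set Filter
open scoped Topology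

variable {d : ℕ} {M : Type*} [TopologicalSpace M] [ChartedSpace (EuclideanSpace ℝ (Fin d)) M]
  {r : ℕ∞}

/-- The difference of the delay vectors of `h` at `y` and `x`, as a linear function of `h`. -/
noncomputable def delayDiff (T : M → M) (k : ℕ) (x y : M) :
    C^(r : ℕ∞ω)⟮𝓡 d, M; ℝ⟯ →ₗ[ℝ] (Fin k → ℝ) where
  toFun h i := h (T^[i] y) - h (T^[i] x)
  map_add' f g := by
    ext i
    change f _ + g _ - (f _ + g _) = (f _ - f _) + (g _ - g _)
    ring
  map_smul' c f := by
    ext i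
    exact (mul_sub c (f (T^[i] y)) (f (T^[i] x))).symm

lemma contMDiff_delayDiff (hr : 1 ≤ r) {T : M → M} (hT : ContMDiff (𝓡 d) (𝓡 d) (r : ℕ∞ω) T)
    (k : ℕ) (x : M) (h : C^(r : ℕ∞ω)⟮𝓡 d, M; ℝ⟯) :
    ContMDiff (𝓡 d) 𝓘(ℝ, Fin k → ℝ) 1 fun y => delayDiff T k x y h :=
  contMDiff_pi_space.2 fun i =>
    ((h.contMDiff.comp (contMDiff_iterate hT i)).sub contMDiff_const).of_le (by exact_mod_cast hr)

lemma continuous_delayDiff [IsManifold (𝓡 d) (r : ℕ∞ω) M] {T : M → M} (hT : Continuous T)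
    (k : ℕ) (x : M) :
    Continuous fun p : C^(r : ℕ∞ω)⟮𝓡 d, M; ℝ⟯ × M => delayDiff T k x p.2 p.1 :=
  continuous_pi fun i =>
    (continuous_eval.comp (continuous_fst.prodMk ((hT.iterate i).comp continuous_snd))).sub
      (continuous_eval.comp (continuous_fst.prodMk continuous_const))

/-- At a single point, almost every perturbation separates if some perturbation does. -/
lemma ae_apply_ne {N : ℕ} (v : C^(r : ℕ∞ω)⟮𝓡 d, M; ℝ⟯)
    (Φ : (Fin N → ℝ) →ₗ[ℝ] C^(r : ℕ∞ω)⟮𝓡 d, M; ℝ⟯) [IsManifold (𝓡 d) (r : ℕ∞ω) M] {x y : M}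
    {a₀ : Fin N → ℝ} (hx : Φ a₀ x = 0) (hy : Φ a₀ y = 1) :
    ∀ᵐ a : Fin N → ℝ, (v + Φ a) y ≠ (v + Φ a) x := by
  have hcont : ∀ z : M, Continuous fun a => (v + Φ a) z := fun z =>
    continuous_eval.comp ((continuous_const.add (continuous_linearMap_of_pi Φ)).prodMk
      continuous_const)
  -- Along `a₀` the difference of the two values grows at unit rate, so equality holds for exactly
  -- one `t` on each line.
  refine ae_mem_of_ae_add_linearMap_mem (s := {a | (v + Φ a) y ≠ (v + Φ a) x})
    (LinearMap.toSpanSingleton ℝ _ a₀) volume volume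
    (isOpen_ne_fun (hcont y) (hcont x)).measurableSet fun b => ?_
  filter_upwards [compl_mem_ae_iff.2
    (measure_singleton (μ := volume) ((v + Φ b) x - (v + Φ b) y))] with t ht heq
  refine ht ?_
  rw [LinearMap.toSpanSingleton_apply, map_add, map_smul] at heq
  have h2 : v y + (Φ b y + t * Φ a₀ y) = v x + (Φ b x + t * Φ a₀ x) := heq
  rw [hx, hy] at h2
  change t = v x + Φ b x - (v y + Φ b y)
  linarith

end Separation

/-! ### Separating a point from a Hausdorff null set. -/

section NullSetSeparation

open Set Filter
open scoped Topology

variable {d : ℕ} {r : ℕ∞} {M : Type*} [EMetricSpace M] [CompactSpace M] [MeasurableSpace M]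
  [BorelSpace M]
  [ChartedSpace (EuclideanSpace ℝ (Fin d)) M] [IsManifold (𝓡 d) (r : ℕ∞ω) M]
  [IsManifold (𝓡 d) 1 M] [Bundle.RiemannianBundle (fun x : M => TangentSpace (𝓡 d) x)]
  [IsContinuousRiemannianBundle (EuclideanSpace ℝ (Fin d))
    (fun x : M => TangentSpace (𝓡 d) x)]
  [IsRiemannianManifold (𝓡 d) M]

/-- Near a point at which the perturbations act transversally, almost every perturbation separates
a given point from a set which is null for the `k`-dimensional Hausdorff measure. -/
lemma exists_nhds_ae_delayDiff_ne_zero (hr : 1 ≤ r) {T : M → M}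
    (hT : ContMDiff (𝓡 d) (𝓡 d) (r : ℕ∞ω) T) {X : Set M} (hX : IsCompact X) {k : ℕ}
    (hHk : μH[(k : ℝ)] X = 0) {N : ℕ} (v : C^(r : ℕ∞ω)⟮𝓡 d, M; ℝ⟯)
    (Φ : (Fin N → ℝ) →ₗ[ℝ] C^(r : ℕ∞ω)⟮𝓡 d, M; ℝ⟯) {x y₀ : M} {c : Fin k → Fin N → ℝ}
    (hc : ∀ i, delayDiff T k x y₀ (Φ (c i)) = Pi.single i 1) :
    ∃ W ∈ 𝓝 y₀, ∀ᵐ a : Fin N → ℝ, ∀ y ∈ X ∩ W, delayDiff T k x y (v + Φ a) ≠ 0 := by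
  -- `Ψ y` is the effect on the delay difference at `y` of moving the parameter in the directions `c
  -- i`. It is the identity at `y₀`, hence invertible nearby.
  let Ψ : M → (Fin k → ℝ) →L[ℝ] (Fin k → ℝ) := fun y =>
    ∑ i, ContinuousLinearMap.smulRightL ℝ (Fin k → ℝ) (Fin k → ℝ) (ContinuousLinearMap.proj i)
      (delayDiff T k x y (Φ (c i)))
  let R : (Fin k → ℝ) →ₗ[ℝ] (Fin N → ℝ) := ∑ i, (LinearMap.proj i).smulRight (c i)
  have hR : ∀ z, R z = ∑ i, z i • c i := fun z => by simp [R]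
  have hΨapply : ∀ y (z : Fin k → ℝ), Ψ y z = delayDiff T k x y (Φ (R z)) := fun y z => by
    simp [Ψ, hR]
  have hΨ : ContMDiff (𝓡 d) 𝓘(ℝ, (Fin k → ℝ) →L[ℝ] (Fin k → ℝ)) 1 Ψ :=
    contMDiff_finsetSum fun i _ =>
      (ContinuousLinearMap.contMDiff _).comp (contMDiff_delayDiff hr hT k x _)
  have hΨ₀ : Ψ y₀ = 1 := by
    ext1 z
    rw [hΨapply]
    simp only [hR, map_sum, map_smul, hc]
    exact (pi_eq_sum_univ' z).symm
  have hU : IsOpen (Ψ ⁻¹' {A | IsUnit A}) := Units.isOpen.preimage hΨ.continuous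
  have hy₀ : y₀ ∈ Ψ ⁻¹' {A | IsUnit A} := by
    rw [mem_preimage, hΨ₀]
    exact isUnit_one
  obtain ⟨W, hW, hWU, hWc⟩ := local_compact_nhds (hU.mem_nhds hy₀)
  refine ⟨W, hW, ?_⟩
  have hclosed : IsClosed {p : (Fin N → ℝ) × M |
      p.2 ∈ X ∩ W ∧ delayDiff T k x p.2 (v + Φ p.1) = 0} :=
    ((hX.inter hWc).isClosed.preimage continuous_snd).inter
      (isClosed_eq ((continuous_delayDiff hT.continuous k x).comp
        ((continuous_const.add ((continuous_linearMap_of_pi Φ).comp continuous_fst)).prodMk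
          continuous_snd)) continuous_const)
  -- Openness supplies the measurability that Fubini requires; it rests on the compactness of `X ∩
  -- W` and `M`.
  have hopen : IsOpen {a | ∀ y ∈ X ∩ W, delayDiff T k x y (v + Φ a) ≠ 0} := by
    convert! (isClosedMap_fst_of_compactSpace _ hclosed).isOpen_compl
    ext a
    simp
  refine ae_mem_of_ae_add_linearMap_mem R volume volume hopen.measurableSet fun b => ?_
  have hsmooth : ∀ y ∈ Ψ ⁻¹' {A | IsUnit A}, ContMDiffAt (𝓡 d) 𝓘(ℝ, Fin k → ℝ) 1
      (fun y => -(Ring.inverse (Ψ y)) (delayDiff T k x y (v + Φ b))) y := fun y hy => by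
    obtain ⟨A, hA⟩ := hy
    have h1 : ContMDiffAt 𝓘(ℝ, (Fin k → ℝ) →L[ℝ] (Fin k → ℝ))
        𝓘(ℝ, (Fin k → ℝ) →L[ℝ] (Fin k → ℝ)) 1 Ring.inverse (Ψ y) := by
      rw [← hA]
      exact (contDiffAt_ringInverse ℝ A).contMDiffAt
    exact ((h1.comp y hΨ.contMDiffAt).clm_apply
      (contMDiff_delayDiff hr hT k x _).contMDiffAt).neg
  -- If the parameter `b + R z` fails at `y`, then `z = -(Ψ y)⁻¹ (delayDiff T k x y (v + Φ b))`. The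
  -- bad `z` thus lie in a `C^1` image of a part of `X`, which is null for `μH[k]`, that is, for
  -- Lebesgue measure on `ℝ^k`.
  have hnull := hausdorffMeasure_image_eq_zero hsmooth k.cast_nonneg hHk
  have hvol : (μH[(k : ℝ)] : Measure (Fin k → ℝ)) = volume := by
    have := hausdorffMeasure_pi_real (ι := Fin k)
    rwa [Fintype.card_fin] at this
  rw [hvol] at hnull
  filter_upwards [compl_mem_ae_iff.2 hnull] with z hz y hy h0
  refine hz ⟨y, ⟨hy.1, hWU hy.2⟩, ?_⟩
  rw [map_add Φ, ← add_assoc, map_add, ← hΨapply] at h0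
  simp only [eq_neg_of_add_eq_zero_left h0, map_neg, neg_neg]
  exact congr($(Ring.inverse_mul_cancel (Ψ y) (hWU hy.2)) z)

/-- Almost every perturbation separates a point whose orbit does not close up in less than `k`
steps from all other points of a set which is null for the `k`-dimensional Hausdorff measure. -/
theorem ae_delayDiff_ne_zero (hr : 1 ≤ r) {T : M → M} (hTinj : Function.Injective T)
    (hT : ContMDiff (𝓡 d) (𝓡 d) (r : ℕ∞ω) T) {X : Set M} (hX : IsCompact X) {k : ℕ} (hk : 0 < k)
    (hHk : μH[(k : ℝ)] X = 0) {N : ℕ} (v : C^(r : ℕ∞ω)⟮𝓡 d, M; ℝ⟯)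
    (Φ : (Fin N → ℝ) →ₗ[ℝ] C^(r : ℕ∞ω)⟮𝓡 d, M; ℝ⟯)
    (hΦ : ∀ (p : M) (s : Finset M), p ∉ s → s.card < 2 * k →
      ∃ a, Φ a p = 1 ∧ ∀ q ∈ s, Φ a q = 0)
    {x : M} (hx : InjOn (fun i => T^[i] x) (Iio k)) :
    ∀ᵐ a : Fin N → ℝ, ∀ y ∈ X, y ≠ x → delayDiff T k x y (v + Φ a) ≠ 0 := by
  classical
  -- The points whose orbit segment of length `k` meets that of `x`, where interpolation cannot
  -- treat the two segments independently. They are finitely many and are separated one at a time by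
  -- the first delay coordinate.
  set O : Set M := ⋃ i ∈ Iio k, ⋃ j ∈ Iio k, T^[i] ⁻¹' {T^[j] x}
  have hO : O.Finite := (finite_Iio k).biUnion fun i _ => (finite_Iio k).biUnion fun j _ =>
    (finite_singleton _).preimage (hTinj.iterate i).injOn
  have hOae : ∀ᵐ a : Fin N → ℝ, ∀ y ∈ O \ {x}, (v + Φ a) y ≠ (v + Φ a) x := by
    refine (ae_ball_iff (hO.subset sdiff_subset).countable).2 fun y hy => ?_
    obtain ⟨a₀, h1, h0⟩ := hΦ y {x} (by simpa using hy.2) (by simp; omega)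
    exact ae_apply_ne v Φ (h0 x (by simp)) h1
  have hW : ∀ y ∈ Oᶜ, ∃ W ∈ 𝓝 y, ∀ᵐ a : Fin N → ℝ, ∀ z ∈ X ∩ W,
      delayDiff T k x z (v + Φ a) ≠ 0 := fun y hy => by
    have hne : ∀ i < k, ∀ j < k, T^[i] y ≠ T^[j] x := fun i hi j hj h =>
      hy (mem_iUnion₂.2 ⟨i, hi, mem_iUnion₂.2 ⟨j, hj, h⟩⟩)
    have hex : ∀ i : Fin k, ∃ a, delayDiff T k x y (Φ a) = Pi.single i 1 := fun i => by
      have hnot : T^[i] x ∉ ((Finset.range k).erase i).image (fun l => T^[l] x) ∪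
          (Finset.range k).image fun l => T^[l] y := fun h => by
        rcases Finset.mem_union.1 h with h | h
        · obtain ⟨l, hl, hlx⟩ := Finset.mem_image.1 h
          obtain ⟨hli, hl⟩ := Finset.mem_erase.1 hl
          exact hli (hx (Finset.mem_range.1 hl) i.2 hlx)
        · obtain ⟨l, hl, hlx⟩ := Finset.mem_image.1 h
          exact hne l (Finset.mem_range.1 hl) i i.2 hlx
      -- The observable must vanish at `k - 1` points on the orbit of `x` and at most `k` on that of
      -- `y`: at most `2 * k - 1` in all.
      have hcard : (((Finset.range k).erase i).image (fun l => T^[l] x) ∪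
          (Finset.range k).image fun l => T^[l] y).card < 2 * k := by
        refine (Finset.card_union_le _ _).trans_lt ?_
        have h1 := (Finset.card_image_le (s := (Finset.range k).erase i) (f := fun l => T^[l] x))
        have h2 := (Finset.card_image_le (s := Finset.range k) (f := fun l => T^[l] y))
        rw [Finset.card_erase_of_mem (Finset.mem_range.2 i.2), Finset.card_range] at h1
        rw [Finset.card_range] at h2
        omega
      obtain ⟨a, ha1, ha0⟩ := hΦ (T^[i] x) _ hnot hcard
      refine ⟨-a, funext fun l => ?_⟩
      have hl : Φ a (T^[l] y) = 0 := ha0 _ (Finset.mem_union_right _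
        (Finset.mem_image_of_mem _ (Finset.mem_range.2 l.2)))
      rw [map_neg]
      change -(Φ a (T^[l] y)) - -(Φ a (T^[l] x)) = _
      rw [hl, neg_zero, zero_sub, neg_neg]
      rcases eq_or_ne l i with rfl | hli
      · rw [ha1, Pi.single_eq_same]
      · rw [Pi.single_eq_of_ne hli]
        exact ha0 _ (Finset.mem_union_left _ (Finset.mem_image_of_mem _
          (Finset.mem_erase.2 ⟨fun h => hli (Fin.ext h), Finset.mem_range.2 l.2⟩)))
    choose c hc using hex
    exact exists_nhds_ae_delayDiff_ne_zero hr hT hX hHk v Φ hc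
  choose! W hWn hWae using hW
  obtain ⟨t, htO, ht, hcov⟩ := TopologicalSpace.countable_cover_nhdsWithin
    (f := W) (s := Oᶜ) fun y hy => mem_nhdsWithin_of_mem_nhds (hWn y hy)
  filter_upwards [hOae, (ae_ball_iff ht).2 fun y hy => hWae y (htO hy)] with a ha hat y hy hyx
  by_cases hyO : y ∈ O
  · intro h0
    exact ha y ⟨hyO, hyx⟩ (sub_eq_zero.1 (congrFun h0 ⟨0, hk⟩))
  · obtain ⟨z, hz, hyz⟩ := mem_iUnion₂.1 (hcov hyO)
    exact hat z hz y ⟨hy, hyz⟩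

end NullSetSeparation

/-! ### Assembling the generic properties. -/

section Main

open Set Filter
open scoped Topology

/-- A coincidence `T^i x = T^j x` with `i < j < k` would, after cancelling `T^i`, make `x` periodic
with period `j - i < k`. -/
lemma injOn_iterate_of_not_periodic {M : Type*} {T : M → M} (hT : Function.Injective T) {k : ℕ}
    {x : M} (hx : ∀ p ∈ Ico 1 k, T^[p] x ≠ x) : InjOn (fun i => T^[i] x) (Iio k) := by
  have key : ∀ i j, i < j → j < k → T^[i] x ≠ T^[j] x := fun i j hij hj h => by
    refine hx (j - i) ⟨by omega, by omega⟩ (hT.iterate i ?_)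
    rw [← Function.iterate_add_apply, Nat.add_sub_cancel' hij.le, h]
  intro i hi j hj h
  rcases lt_trichotomy i j with hij | hij | hij
  · exact absurd h (key i j hij hj)
  · exact hij
  · exact absurd h.symm (key j i hij hi)

variable {d : ℕ} {M : Type*} {r : ℕ∞}

/-- The pairs of an observable and a point at which the next delay vector depends in an
`n`-Lipschitz way on the current one. -/
def lipschitzPairs [TopologicalSpace M] [ChartedSpace (EuclideanSpace ℝ (Fin d)) M]
    (T : M → M) (X : Set M) (k n : ℕ) : Set (C^(r : ℕ∞ω)⟮𝓡 d, M; ℝ⟯ × M) :=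
  {p | ∀ y ∈ X, ‖delayMap T p.1 k (T y) - delayMap T p.1 k (T p.2)‖ ≤
    n * ‖delayMap T p.1 k y - delayMap T p.1 k p.2‖}

section

variable [TopologicalSpace M] [ChartedSpace (EuclideanSpace ℝ (Fin d)) M] {T : M → M}

lemma monotone_lipschitzPairs (X : Set M) (k : ℕ) :
    Monotone (lipschitzPairs (d := d) (r := r) T X k) := fun m n hmn p hp y hy =>
  (hp y hy).trans (by gcongr)

/-- Each condition is a non-strict inequality between functions jointly continuous in the observable
and the point. Closedness is what makes the good observables a Borel set. -/
lemma isClosed_lipschitzPairs [IsManifold (𝓡 d) (r : ℕ∞ω) M] (hT : Continuous T) (X : Set M)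
    (k n : ℕ) : IsClosed (lipschitzPairs (d := d) (r := r) T X k n) := by
  have hcont : ∀ g : C^(r : ℕ∞ω)⟮𝓡 d, M; ℝ⟯ × M → M, Continuous g →
      Continuous fun p : C^(r : ℕ∞ω)⟮𝓡 d, M; ℝ⟯ × M => delayMap T p.1 k (g p) := fun g hg =>
    (PiLp.continuous_toLp 2 _).comp (continuous_pi fun i =>
      continuous_eval.comp (continuous_fst.prodMk ((hT.iterate i).comp hg)))
  simp only [lipschitzPairs, ofPred_forall]
  exact isClosed_iInter fun y => isClosed_iInter fun _ => isClosed_le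
    ((hcont _ continuous_const).sub (hcont _ (hT.comp continuous_snd))).norm
    (continuous_const.mul ((hcont _ continuous_const).sub (hcont _ continuous_snd)).norm)

/-- If some element of a finite-dimensional family of observables has a delay map which is an
immersion at `x`, then so has almost every element of each translate of the family. -/
lemma ae_exists_injective_hasFDerivAt (hr : 1 ≤ r) (hT : ContMDiff (𝓡 d) (𝓡 d) (r : ℕ∞ω) T)
    {k N : ℕ} (v : C^(r : ℕ∞ω)⟮𝓡 d, M; ℝ⟯)
    (Φ : (Fin N → ℝ) →ₗ[ℝ] C^(r : ℕ∞ω)⟮𝓡 d, M; ℝ⟯) {x : M}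
    {e : OpenPartialHomeomorph M (EuclideanSpace ℝ (Fin d))}
    (he : e ∈ IsManifold.maximalAtlas (𝓡 d) (r : ℕ∞ω) M) (hx : x ∈ e.source)
    {a₀ : Fin N → ℝ} {L₀ : EuclideanSpace ℝ (Fin d) →L[ℝ] (Fin k → ℝ)}
    (hL₀ : Function.Injective L₀)
    (ha₀ : HasFDerivAt (fun y (i : Fin k) => Φ a₀ (T^[i] (e.symm y))) L₀ (e x)) :
    ∀ᵐ a : Fin N → ℝ, ∃ L : EuclideanSpace ℝ (Fin d) →L[ℝ] (Fin k → ℝ), Function.Injective L ∧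
      HasFDerivAt (fun y (i : Fin k) => (v + Φ a) (T^[i] (e.symm y))) L (e x) := by
  have hdiff : ∀ h : C^(r : ℕ∞ω)⟮𝓡 d, M; ℝ⟯,
      DifferentiableAt ℝ (fun y (i : Fin k) => h (T^[i] (e.symm y))) (e x) := fun h =>
    differentiableAt_pi.2 fun i =>
      (contDiffAt_comp_symm (pullback ⟨T^[i], contMDiff_iterate hT i⟩ h) he (j := 1)
        (by exact_mod_cast hr) (e.map_source hx)).differentiableAt (by simp)
  let D : C^(r : ℕ∞ω)⟮𝓡 d, M; ℝ⟯ →ₗ[ℝ] EuclideanSpace ℝ (Fin d) →L[ℝ] (Fin k → ℝ) :=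
    { toFun := fun h => fderiv ℝ (fun y (i : Fin k) => h (T^[i] (e.symm y))) (e x)
      map_add' := fun f g => fderiv_add (hdiff f) (hdiff g)
      map_smul' := fun c f => fderiv_const_smul (hdiff f) c }
  have hD₀ : D (Φ a₀) = L₀ := ha₀.fderiv
  filter_upwards [ae_injective_add (D v) (D ∘ₗ Φ) (a₀ := a₀)
    (by rwa [LinearMap.comp_apply, hD₀])] with a ha
  exact ⟨D (v + Φ a), by rwa [map_add], (hdiff _).hasFDerivAt⟩

end

end Main

end DelayPrediction

open DelayPrediction in
theorem theorem5p1 {d : ℕ} {M : Type*} [EMetricSpace M] [CompactSpace M]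
    [ChartedSpace (EuclideanSpace ℝ (Fin d)) M]
    (r : ℕ∞) (hr : 1 ≤ r) [IsManifold (𝓡 d) (r : ℕ∞ω) M] [IsManifold (𝓡 d) 1 M]
    [Bundle.RiemannianBundle (fun x : M => TangentSpace (𝓡 d) x)]
    [IsContinuousRiemannianBundle (EuclideanSpace ℝ (Fin d))
      (fun x : M => TangentSpace (𝓡 d) x)]
    [IsRiemannianManifold (𝓡 d) M]
    [MeasurableSpace M] [BorelSpace M]
    (T : Diffeomorph (𝓡 d) (𝓡 d) M M (r : ℕ∞ω))
    (X : Set M) (hX : IsCompact X)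
    (μ : Measure M) [IsProbabilityMeasure μ] (hμX : μ Xᶜ = 0)
    (k : ℕ) (hHk : Measure.hausdorffMeasure (k : ℝ) X = 0) (hdk : d ≤ k)
    (hper : μ (⋃ p ∈ Set.Ico 1 k, {x : M | T^[p] x = x}) = 0) :
    DelayPrediction.IsPrevalent
      {h : ContMDiffMap (𝓡 d) 𝓘(ℝ, ℝ) M ℝ (r : ℕ∞ω) |
        ∀ᵐ x ∂μ,
          DelayPrediction.delayMap T h k x ∈
            (Measure.map (DelayPrediction.delayMap T h k) μ).support ∧
          ∃ C : ℝ, ∀ ε : ℝ, 0 < ε →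
            DelayPrediction.predictionError μ T h k ε (DelayPrediction.delayMap T h k x)
              ≤ C * ε} := by
  have hT := T.contMDiff
  have hTc := hT.continuous
  -- For `k = 0` the Hausdorff measure counts points, so `X` would be empty and could not carry a
  -- probability measure.
  have hk : 0 < k := by
    refine Nat.pos_of_ne_zero fun h0 => ?_
    subst h0
    have hXe : X = ∅ := Set.eq_empty_of_forall_notMem fun x hx => by
      have h1 := measure_mono_null (Set.singleton_subset_iff.2 hx) hHk
      rw [Nat.cast_zero, Measure.hausdorffMeasure_zero_singleton] at h1
      exact one_ne_zero h1
    rw [hXe, Set.compl_empty, measure_univ] at hμX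
    exact one_ne_zero hμX
  obtain ⟨V, hVfg, hinterp, himm⟩ := exists_probe hr T hk hdk
  obtain ⟨N, Φ, hΦ⟩ := (Submodule.fg_iff_exists_fin_linearMap _ _).1 hVfg
  have hΦmem : ∀ g ∈ V, ∃ a, Φ a = g := fun g hg => LinearMap.mem_range.1 (hΦ ▸ hg)
  refine isPrevalent_of_ae_probe μ (continuous_linearMap_of_pi Φ)
    (isClosed_lipschitzPairs hTc X k) (monotone_lipschitzPairs X k) (fun v => ?_) fun h hh => ?_
  · have hper' : ∀ᵐ x ∂μ, x ∉ ⋃ p ∈ Set.Ico 1 k, {x : M | T^[p] x = x} :=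
      measure_eq_zero_iff_ae_notMem.1 hper
    filter_upwards [hper'] with x hx
    have hinj := injOn_iterate_of_not_periodic T.injective fun p hp h =>
      hx (Set.mem_iUnion₂.2 ⟨p, hp, h⟩)
    obtain ⟨e, he, hxe, g, hg, L₀, hL₀, hgL⟩ := himm x hinj
    obtain ⟨a₀, rfl⟩ := hΦmem g hg
    filter_upwards [ae_exists_injective_hasFDerivAt hr hT v Φ he hxe hL₀ hgL,
      ae_delayDiff_ne_zero hr T.injective hT hX hk hHk v Φ (fun p s hp hs => by
        obtain ⟨g, hg, h⟩ := hinterp p s hp hs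
        obtain ⟨a, rfl⟩ := hΦmem g hg
        exact ⟨a, h⟩) hinj] with a ⟨L, hL, haL⟩ hsep
    set h := v + Φ a
    -- `J` passes from the sup norm on `Fin k → ℝ`, used for the generic statements, to the
    -- Euclidean norm of the delay vectors.
    set J := (PiLp.continuousLinearEquiv 2 ℝ fun _ : Fin k => ℝ).symm
    have hd : HasFDerivAt (fun y => delayMap T h k (e.symm y))
        ((J : (Fin k → ℝ) →L[ℝ] EuclideanSpace ℝ (Fin k)) ∘L L) (e x) :=
      (J : (Fin k → ℝ) →L[ℝ] EuclideanSpace ℝ (Fin k)).hasFDerivAt.comp (e x) haL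
    have hcont := continuous_delayMap (k := k) hTc h.contMDiff.continuous
    refine exists_forall_norm_sub_le hcont (hcont.comp hTc) hX (fun y hy hyx heq => ?_) e hxe
      (J.injective.comp hL) hd ?_
    · refine hsep y hy hyx (funext fun i => sub_eq_zero.2 ?_)
      exact congrFun (congrArg WithLp.ofLp heq) i
    -- The coordinates of `φ ∘ T` are `h ∘ T^{i+1}`, so one further iterate must be differentiable.
    · exact J.differentiableAt.comp (e x) (differentiableAt_pi.2 fun i =>
        (contDiffAt_comp_symm (pullback ⟨T^[i + 1], contMDiff_iterate hT (i + 1)⟩ h) he (j := 1)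
          (by exact_mod_cast hr) (e.map_source hxe)).differentiableAt (by simp))
  · filter_upwards [hh, delayMap_mem_support_ae hTc h.contMDiff.continuous] with x ⟨n, hn⟩ hsupp
    exact ⟨hsupp, 2 * n, fun ε hε =>
      predictionError_le hTc h.contMDiff.continuous hμX n.cast_nonneg hn hε⟩
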